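/- Let $I$ be a small filtered category, and let $\mathcal{C}$ be a locally finitely presentable simplicial model category (in particular $\mathcal{C}$ is complete and cocomplete, enriched over the category $\mathbf{S}$ of simplicial sets, and has a tensor $K\circledast X$ and a cotensor $X^{K}$ for $K\in\mathbf{S}$, $X\in\mathcal{C}$). Suppose that (i) the tensor $\mathbf{S}\times\mathcal{C}\to\mathcal{C}$ preserves finitely presentable objects: if $K\in\mathbf{S}$ and $X\in\mathcal{C}$ are finitely presentable, then so is $K\circledast X$; (ii) an $I$-indexed colimit of weak equivalences of $\mathcal{C}$ is a weak equivalence: if $f:X\to Y$ is a morphism of functors $I\to\mathcal{C}$ with every $f_i$ a weak equivalence, then $\operatorname{colim}_I f$ is a weak equivalence; (iii) an $I$-indexed colimit of fibrant objects of $\mathcal{C}$ is fibrant. Let $J$ be a finite category such that for each object $j$ of $J$ the nerve $N(J\downarrow j)$ of the category of objects over $j$ is a finitely presentable simplicial set. For $\mathcal{Y}:J\to\mathcal{C}$, let $\operatorname{holim}_J\mathcal{Y}=\int_{j\in J}\mathcal{Y}(j)^{N(J\downarrow j)}$, that is, the equalizer of the two natural maps $\prod_{j}\mathcal{Y}(j)^{N(J\downarrow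 j)}\rightrightarrows\prod_{j\to k}\mathcal{Y}(k)^{N(J\downarrow j)}$. Let $\hat F:\mathcal{C}\to\mathcal{C}$ be any fibrant approximation on $\mathcal{C}$, that is, a functor with fibrant values together with a natural transformation $\mathrm{Id}\Rightarrow\hat F$ which is objectwise a weak equivalence, and let $\operatorname{cholim}_J\mathcal{Y}=\operatorname{holim}_J(\hat F\circ\mathcal{Y})$. Then for every functor $\mathcal{X}:I\to\mathcal{C}^{J}$, the natural map $$\operatorname{colim}_I\operatorname{cholim}_J\mathcal{X}\longrightarrow\operatorname{cholim}_J(\operatorname{colim}_I\mathcal{X})$$ is a weak equivalence. -/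

import Mathlib

open CategoryTheory Limits Opposite HomotopicalAlgebra

universe v u

noncomputable section

namespace SimplicialHolim

/-- A category `C` enriched over simplicial sets is tensored and cotensored when there are a tensor
`K ⊗ X` and a cotensor `Y ^ K` together with isomorphisms of simplicial sets
`Map(K ⊗ X, Y) ≅ Map(K, Map(X, Y)) ≅ Map(X, Y ^ K)` which are natural in `K`, `X` and `Y`.
Here `Map(X, Y)` is `SimplicialCategory.sHom X Y`, and `Map(K, L)` for simplicial sets is the
internal hom `(ihom K).obj L`. -/
class TensoredCotensored (C : Type u) [Category.{v} C] [SimplicialCategory C] where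
  /-- the tensor `(K, X) ↦ K ⊗ X` -/
  tensor : SSet.{v} ⥤ C ⥤ C
  /-- the cotensor `(K, Y) ↦ Y ^ K` -/
  cotensor : SSet.{v}ᵒᵖ ⥤ C ⥤ C
  /-- `Map(K ⊗ X, Y) ≅ Map(K, Map(X, Y))` -/
  tensorIso (K : SSet.{v}) (X Y : C) :
    SimplicialCategory.sHom ((tensor.obj K).obj X) Y ≅
      (ihom K).obj (SimplicialCategory.sHom X Y)
  /-- `Map(X, Y ^ K) ≅ Map(K, Map(X, Y))` -/
  cotensorIso (K : SSet.{v}) (X Y : C) :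
    SimplicialCategory.sHom X ((cotensor.obj (op K)).obj Y) ≅
      (ihom K).obj (SimplicialCategory.sHom X Y)
  tensorIso_naturality_left {K L : SSet.{v}} (f : K ⟶ L) (X Y : C) :
    eHomWhiskerRight SSet.{v} ((tensor.map f).app X) Y ≫ (tensorIso K X Y).hom =
      (tensorIso L X Y).hom ≫ (MonoidalClosed.pre f).app (SimplicialCategory.sHom X Y)
  tensorIso_naturality_middle (K : SSet.{v}) {X X' : C} (g : X ⟶ X') (Y : C) :
    eHomWhiskerRight SSet.{v} ((tensor.obj K).map g) Y ≫ (tensorIso K X Y).hom =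
      (tensorIso K X' Y).hom ≫ (ihom K).map (eHomWhiskerRight SSet.{v} g Y)
  tensorIso_naturality_right (K : SSet.{v}) (X : C) {Y Y' : C} (h : Y ⟶ Y') :
    eHomWhiskerLeft SSet.{v} ((tensor.obj K).obj X) h ≫ (tensorIso K X Y').hom =
      (tensorIso K X Y).hom ≫ (ihom K).map (eHomWhiskerLeft SSet.{v} X h)
  cotensorIso_naturality_left {K L : SSet.{v}} (f : K ⟶ L) (X Y : C) :
    eHomWhiskerLeft SSet.{v} X ((cotensor.map f.op).app Y) ≫ (cotensorIso K X Y).hom =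
      (cotensorIso L X Y).hom ≫ (MonoidalClosed.pre f).app (SimplicialCategory.sHom X Y)
  cotensorIso_naturality_middle (K : SSet.{v}) {X X' : C} (g : X ⟶ X') (Y : C) :
    eHomWhiskerRight SSet.{v} g ((cotensor.obj (op K)).obj Y) ≫ (cotensorIso K X Y).hom =
      (cotensorIso K X' Y).hom ≫ (ihom K).map (eHomWhiskerRight SSet.{v} g Y)
  cotensorIso_naturality_right (K : SSet.{v}) (X : C) {Y Y' : C} (h : Y ⟶ Y') :
    eHomWhiskerLeft SSet.{v} X ((cotensor.obj (op K)).map h) ≫ (cotensorIso K X Y').hom =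
      (cotensorIso K X Y).hom ≫ (ihom K).map (eHomWhiskerLeft SSet.{v} X h)

/-- The map `Map(B, X) ⟶ Map(A, X) ×_{Map(A, Y)} Map(B, Y)` induced by `i : A ⟶ B` and
`p : X ⟶ Y`. -/
def cornerMap {C : Type u} [Category.{v} C] [SimplicialCategory C]
    {A B X Y : C} (i : A ⟶ B) (p : X ⟶ Y) :
    SimplicialCategory.sHom B X ⟶
      pullback (eHomWhiskerLeft SSet.{v} A p) (eHomWhiskerRight SSet.{v} i Y) :=
  pullback.lift (eHomWhiskerRight SSet.{v} i X) (eHomWhiskerLeft SSet.{v} B p)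
    (eHom_whisker_exchange SSet.{v} i p).symm

/-- A simplicial model category: a (small) complete and cocomplete model category which is enriched,
tensored and cotensored over simplicial sets, and such that for every cofibration `i` and every
fibration `p` the corner map is a Kan fibration, which is a trivial Kan fibration if `i` or `p` is a
weak equivalence. A Kan fibration has the right lifting property with respect to the horn inclusions
`Λ[n, k] ⟶ Δ[n]` (the class `SSet.modelCategoryQuillen.J`), and a trivial Kan fibration has it with
respect to the boundary inclusions `∂Δ[n] ⟶ Δ[n]` (the class `SSet.modelCategoryQuillen.I`). -/
class IsSimplicialModelCategory (C : Type u) [Category.{v} C] [ModelCategory C]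
    [SimplicialCategory C] [TensoredCotensored C] : Prop where
  hasLimits : HasLimitsOfSize.{v, v} C
  hasColimits : HasColimitsOfSize.{v, v} C
  fibration_cornerMap {A B X Y : C} (i : A ⟶ B) (p : X ⟶ Y)
    (hi : Cofibration i) (hp : Fibration p) :
    SSet.modelCategoryQuillen.J.{v}.rlp (cornerMap i p)
  trivialFibration_cornerMap {A B X Y : C} (i : A ⟶ B) (p : X ⟶ Y)
    (hi : Cofibration i) (hp : Fibration p) (h : WeakEquivalence i ∨ WeakEquivalence p) :
    SSet.modelCategoryQuillen.I.{v}.rlp (cornerMap i p)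

attribute [instance] IsSimplicialModelCategory.hasLimits IsSimplicialModelCategory.hasColimits

/-- A (functorial) fibrant approximation: a functor `F : C ⥤ C` with values in fibrant objects and a
natural weak equivalence from the identity to `F`. -/
structure FibrantApproximation (C : Type u) [Category.{v} C] [ModelCategory C] where
  functor : C ⥤ C
  ι : 𝟭 C ⟶ functor
  weakEquivalence_app (X : C) : WeakEquivalence (ι.app X)
  isFibrant_obj (X : C) : IsFibrant (functor.obj X)

section

variable (C : Type u) [Category.{v} C] [ModelCategory C] [SimplicialCategory C]
  [TensoredCotensored C] [IsSimplicialModelCategory C] (J : Type v) [SmallCategory J]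

/-- The functor `j ↦ N(J ↓ j)`. -/
def nerveOver : J ⥤ SSet.{v} := Over.mapFunctor J ⋙ nerveFunctor

/-- The functor sending `X : J ⥤ C` to the bifunctor `(j, k) ↦ X k ^ N(J ↓ j)`. -/
def cotensorNerve : (J ⥤ C) ⥤ (Jᵒᵖ ⥤ J ⥤ C) where
  obj X := ((nerveOver J).op ⋙ TensoredCotensored.cotensor) ⋙ (Functor.whiskeringLeft J C C).obj X
  map f := Functor.whiskerLeft ((nerveOver J).op ⋙ TensoredCotensored.cotensor)
    ((Functor.whiskeringLeft J C C).map f)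

/-- The homotopy limit of `X : J ⥤ C`: the end of `(j, k) ↦ X k ^ N(J ↓ j)`, that is, the equalizer
of the two maps `∏ j, X j ^ N(J ↓ j) ⇉ ∏ (j ⟶ k), X k ^ N(J ↓ j)`. -/
def holim : (J ⥤ C) ⥤ C := cotensorNerve C J ⋙ endFunctor J C

variable {C}

/-- The corrected homotopy limit: apply a fibrant approximation objectwise, then `holim`. -/
def cholim (F : FibrantApproximation C) : (J ⥤ C) ⥤ C :=
  (Functor.whiskeringRight J C C).obj F.functor ⋙ holim C J

end

end SimplicialHolim

end

/-! The natural map factors as colim holim(F X) ⟶ holim(colim F X) ⟶ holim(F colim X).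

The first map is an isomorphism because `holim` preserves filtered colimits
(`isFinitelyAccessible_holim`). Finitely presentable objects G detect this. Hom(G, Y ^ K) = Hom(K ⊗
G, Y) with K ⊗ G finitely presentable, and an end over a finite category is a finite limit.

The second map is `holim` of an objectwise weak equivalence between objectwise fibrant diagrams:
(iii) gives fibrancy, (ii) and two-out-of-three give the equivalence. That `holim` preserves such
maps (`weakEquivalence_holim_map`) follows Ken Brown's argument, with mapping path objects, from the
case of objectwise trivial fibrations (`trivialFibrations_holim_map`). There, maps A ⟶ holim X are
natural transformations N(J ↓ -) ⟶ Map(A, X -), so it suffices that N(J ↓ -) lifts against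
objectwise trivial Kan fibrations (`exists_lift_nerveOver`). Such transformations into E amount to
sections over N(J) of the relative nerve of E, and the relative nerve carries objectwise trivial Kan
fibrations to trivial Kan fibrations (`rlp_relNerveMap`). -/

noncomputable section

namespace SimplicialHolim

open MonoidalCategory MonoidalClosed

/-! ### Tensors and cotensors on the level of hom-sets -/

section TensoredCotensored

lemma eHomEquiv_comp_eHomWhiskerRight {V : Type*} [Category* V] [MonoidalCategory V]
    {C : Type*} [Category* C] [EnrichedOrdinaryCategory V C] {X X' Y : C} (g : X ⟶ X')
    (f : X' ⟶ Y) : eHomEquiv V (g ≫ f) = eHomEquiv V f ≫ eHomWhiskerRight V g Y := by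
  rw [eHomEquiv_comp, eHomWhiskerRight, leftUnitor_inv_naturality_assoc,
    whisker_exchange_assoc, tensorHom_def_assoc]

lemma eHomEquiv_comp_eHomWhiskerLeft {V : Type*} [Category* V] [MonoidalCategory V]
    {C : Type*} [Category* C] [EnrichedOrdinaryCategory V C] {X Y Y' : C} (f : X ⟶ Y)
    (h : Y ⟶ Y') : eHomEquiv V (f ≫ h) = eHomEquiv V f ≫ eHomWhiskerLeft V X h := by
  rw [eHomEquiv_comp, eHomWhiskerLeft, rightUnitor_inv_naturality_assoc,
    tensorHom_def_assoc, unitors_inv_equal]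

lemma uncurry'_comp_ihom_map {V : Type*} [Category* V] [MonoidalCategory V] {K M N : V} [Closed K]
    (f : 𝟙_ V ⟶ (ihom K).obj M) (g : M ⟶ N) :
    uncurry' (f ≫ (ihom K).map g) = uncurry' f ≫ g := by
  simp [uncurry', uncurry_natural_right]

lemma uncurry'_comp_pre {V : Type*} [Category* V] [MonoidalCategory V] {K L M : V} [Closed K]
    [Closed L] (k : K ⟶ L) (f : 𝟙_ V ⟶ (ihom L).obj M) :
    uncurry' (f ≫ (pre k).app M) = k ≫ uncurry' f := by
  simp [uncurry', uncurry_pre_app]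

variable {C : Type u} [Category.{v} C] [SimplicialCategory C] [TensoredCotensored C]

/-- The cotensor of an object by a simplicial set. -/
abbrev cot (K : SSet.{v}) (Y : C) : C := (TensoredCotensored.cotensor.obj (op K)).obj Y

/-- The restriction map between cotensors. -/
abbrev cotRestr {K L : SSet.{v}} (k : K ⟶ L) (Y : C) : cot L Y ⟶ cot K Y :=
  (TensoredCotensored.cotensor.map k.op).app Y

/-- Maps into a cotensor `Y ^ K` are maps from `K` into the mapping space. -/
def homCotEquiv (K : SSet.{v}) (A Y : C) :
    (A ⟶ cot K Y) ≃ (K ⟶ SimplicialCategory.sHom A Y) :=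
  ((eHomEquiv SSet.{v}).trans
    ((Iso.refl _).homCongr (TensoredCotensored.cotensorIso K A Y))).trans curryHomEquiv'.symm

/-- Maps out of a tensor `K ⊗ X` are maps from `K` into the mapping space. -/
def homTensorEquiv (K : SSet.{v}) (X Y : C) :
    ((TensoredCotensored.tensor.obj K).obj X ⟶ Y) ≃ (K ⟶ SimplicialCategory.sHom X Y) :=
  ((eHomEquiv SSet.{v}).trans
    ((Iso.refl _).homCongr (TensoredCotensored.tensorIso K X Y))).trans curryHomEquiv'.symm

lemma homCotEquiv_apply (K : SSet.{v}) {A Y : C} (f : A ⟶ cot K Y) :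
    homCotEquiv K A Y f =
      uncurry' (eHomEquiv SSet.{v} f ≫ (TensoredCotensored.cotensorIso K A Y).hom) := by
  simp [homCotEquiv, curryHomEquiv']

lemma homTensorEquiv_apply (K : SSet.{v}) {X Y : C}
    (f : (TensoredCotensored.tensor.obj K).obj X ⟶ Y) :
    homTensorEquiv K X Y f =
      uncurry' (eHomEquiv SSet.{v} f ≫ (TensoredCotensored.tensorIso K X Y).hom) := by
  simp [homTensorEquiv, curryHomEquiv']

/-- This and the next naturality statements allow lifting problems in `C` to be transposed to
lifting problems of simplicial sets. -/
lemma homCotEquiv_comp_left (K : SSet.{v}) {A A' Y : C} (g : A ⟶ A') (f : A' ⟶ cot K Y) :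
    homCotEquiv K A Y (g ≫ f) = homCotEquiv K A' Y f ≫ eHomWhiskerRight SSet.{v} g Y := by
  rw [homCotEquiv_apply, homCotEquiv_apply, ← uncurry'_comp_ihom_map, Category.assoc,
    ← TensoredCotensored.cotensorIso_naturality_middle, eHomEquiv_comp_eHomWhiskerRight,
    Category.assoc]

lemma homCotEquiv_comp_map (K : SSet.{v}) {A Y Y' : C} (f : A ⟶ cot K Y) (h : Y ⟶ Y') :
    homCotEquiv K A Y' (f ≫ (TensoredCotensored.cotensor.obj (op K)).map h) =
      homCotEquiv K A Y f ≫ eHomWhiskerLeft SSet.{v} A h := by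
  rw [homCotEquiv_apply, homCotEquiv_apply, ← uncurry'_comp_ihom_map, Category.assoc,
    ← TensoredCotensored.cotensorIso_naturality_right, eHomEquiv_comp_eHomWhiskerLeft,
    Category.assoc]

lemma homCotEquiv_comp_cotRestr {K L : SSet.{v}} (k : K ⟶ L) {A Y : C} (f : A ⟶ cot L Y) :
    homCotEquiv K A Y (f ≫ cotRestr k Y) = k ≫ homCotEquiv L A Y f := by
  rw [homCotEquiv_apply, homCotEquiv_apply, ← uncurry'_comp_pre, Category.assoc,
    ← TensoredCotensored.cotensorIso_naturality_left, eHomEquiv_comp_eHomWhiskerLeft,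
    Category.assoc]

lemma homTensorEquiv_comp (K : SSet.{v}) {X Y Y' : C}
    (f : (TensoredCotensored.tensor.obj K).obj X ⟶ Y) (h : Y ⟶ Y') :
    homTensorEquiv K X Y' (f ≫ h) = homTensorEquiv K X Y f ≫ eHomWhiskerLeft SSet.{v} X h := by
  rw [homTensorEquiv_apply, homTensorEquiv_apply, ← uncurry'_comp_ihom_map, Category.assoc,
    ← TensoredCotensored.tensorIso_naturality_right, eHomEquiv_comp_eHomWhiskerLeft,
    Category.assoc]

/-- Mapping into cotensors by `K` is corepresented by tensors with `K`. -/
def coyonedaTensorIso (K : SSet.{v}) (X : C) :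
    coyoneda.obj (op ((TensoredCotensored.tensor.obj K).obj X)) ≅
      TensoredCotensored.cotensor.obj (op K) ⋙ coyoneda.obj (op X) :=
  NatIso.ofComponents
    (fun Y ↦ ((homTensorEquiv K X Y).trans (homCotEquiv K X Y).symm).toIso) (by
      intro Y Y' h
      ext f
      apply (homCotEquiv K X Y').injective
      dsimp
      simp [homTensorEquiv_comp, homCotEquiv_comp_map])

end TensoredCotensored

/-! ### Finite ends and filtered colimits -/

section FilteredColimits

open Cardinal

attribute [local instance] fact_isRegular_aleph0

/-- A morphism which induces bijections on maps out of a strong generator is an isomorphism. -/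
lemma isIso_of_isStrongGenerator {C : Type*} [Category* C] {P : ObjectProperty C}
    (hP : P.IsStrongGenerator) {X Y : C} (f : X ⟶ Y)
    (hf : ∀ G, P G → Function.Bijective (fun g : G ⟶ X ↦ g ≫ f)) : IsIso f := by
  have : Mono f := ⟨fun {Z} a b hab ↦ hP.isSeparating _ _ fun G hG g ↦
    (hf G hG).1 (by simp [hab])⟩
  exact hP.isIso_of_mono f fun G hG ↦ (hf G hG).2

/-- In a locally finitely presentable category, a functor preserves filtered colimits as soon as it
does so after mapping out of finitely presentable objects. -/
lemma isFinitelyAccessible_of_coyoneda {C : Type u} [Category.{v} C]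
    [IsLocallyFinitelyPresentable.{v} C] {D : Type*} [Category* D] (H : D ⥤ C)
    (hH : ∀ G : C, IsFinitelyPresentable.{v} G →
      Functor.IsFinitelyAccessible.{v} (H ⋙ coyoneda.obj (op G))) :
    Functor.IsFinitelyAccessible.{v} H where
  preservesColimitOfShape J _ _ := by
    refine ⟨fun {F} ↦ ⟨fun {c} hc ↦ ?_⟩⟩
    obtain ⟨P, _, hP⟩ := HasCardinalFilteredGenerator.exists_generator C ℵ₀
    have : IsIso (colimit.desc (F ⋙ H) (H.mapCocone c)) := by
      refine isIso_of_isStrongGenerator hP.isStrongGenerator _ fun G hG ↦ ?_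
      have hG' : IsFinitelyPresentable.{v} G := hP.le_isCardinalPresentable _ hG
      have := hH G hG'
      have := (H ⋙ coyoneda.obj (op G)).preservesColimitsOfShape_of_isCardinalAccessible ℵ₀ J
      have := preservesColimitsOfShape_of_isCardinalPresentable G ℵ₀ J
      -- Hom(G, -) of the source and of the target of the comparison map are colimits of the same
      -- diagram: one since `G` is finitely presentable, the other by `hH`.
      have h₁ := isColimitOfPreserves (H ⋙ coyoneda.obj (op G)) hc
      have h₂ := isColimitOfPreserves (coyoneda.obj (op G)) (colimit.isColimit (F ⋙ H))
      have : (fun g : G ⟶ colimit (F ⋙ H) ↦ g ≫ colimit.desc (F ⋙ H) (H.mapCocone c)) =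
          ⇑(ConcreteCategory.hom (h₂.coconePointUniqueUpToIso h₁).hom) := by
        have : (coyoneda.obj (op G)).map (colimit.desc (F ⋙ H) (H.mapCocone c)) =
            (h₂.coconePointUniqueUpToIso h₁).hom := by
          refine h₂.hom_ext fun j ↦ ?_
          rw [h₂.comp_coconePointUniqueUpToIso_hom]
          exact ((coyoneda.obj (op G)).map_comp _ _).symm.trans
            (congrArg (coyoneda.obj (op G)).map (colimit.ι_desc (H.mapCocone c) j))
        rw [← this]
        rfl
      rw [this]
      exact (h₂.coconePointUniqueUpToIso h₁).toEquiv.bijective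
    have : IsIso ((colimit.isColimit (F ⋙ H)).desc (H.mapCocone c)) := this
    exact ⟨IsColimit.ofPointIso (colimit.isColimit _)⟩

variable {C : Type u} [Category.{v} C] {J : Type v} [SmallCategory J]
  [∀ F : Jᵒᵖ ⥤ J ⥤ C, HasEnd F] {D : Type*} [Category* D]

/-- The diagram whose limit is the functor `d ↦ Hom(G, ∫ E(d))`. -/
def endCoyonedaIndex (E : D ⥤ Jᵒᵖ ⥤ J ⥤ C) (G : C) :
    MulticospanIndex (multicospanShapeEnd J) (D ⥤ Type v) where
  left j := E ⋙ (evaluation _ _).obj (op j) ⋙ (evaluation _ _).obj j ⋙ coyoneda.obj (op G)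
  right f := E ⋙ (evaluation _ _).obj (op f.left) ⋙ (evaluation _ _).obj f.right ⋙
    coyoneda.obj (op G)
  fst f := Functor.whiskerLeft E (Functor.whiskerLeft ((evaluation _ _).obj (op f.left))
    (Functor.whiskerRight ((evaluation _ _).map f.hom) (coyoneda.obj (op G))))
  snd f := Functor.whiskerLeft E (Functor.whiskerRight ((evaluation _ _).map f.hom.op)
    ((evaluation _ _).obj f.right ⋙ coyoneda.obj (op G)))

/-- The functor `d ↦ Hom(G, ∫ E(d))` as a multifork. -/
def endCoyonedaFork (E : D ⥤ Jᵒᵖ ⥤ J ⥤ C) (G : C) : Multifork (endCoyonedaIndex E G) :=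
  Multifork.ofι _ (E ⋙ endFunctor J C ⋙ coyoneda.obj (op G))
    (fun (j : J) ↦
      { app d := ↾fun g : G ⟶ end_ (E.obj d) ↦ g ≫ end_.π (E.obj d) j
        naturality d d' f := by
          ext (g : G ⟶ end_ (E.obj d))
          have : (g ≫ end_.map (E.map f)) ≫ end_.π (E.obj d') j =
              (g ≫ end_.π (E.obj d) j) ≫ ((E.map f).app (op j)).app j := by simp
          exact this })
    (fun f ↦ by
      ext d (g : G ⟶ end_ (E.obj d))
      have : (g ≫ end_.π (E.obj d) f.left) ≫ ((E.obj d).obj (op f.left)).map f.hom =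
          (g ≫ end_.π (E.obj d) f.right) ≫ ((E.obj d).map f.hom.op).app f.right := by
        simp [end_.condition]
      exact this)

/-- The map to an end which is determined by an element of a multifork on `endCoyonedaIndex`. -/
def endCoyonedaLift (E : D ⥤ Jᵒᵖ ⥤ J ⥤ C) (G : C) (K : Multifork (endCoyonedaIndex E G)) (d : D)
    (x : K.pt.obj d) : G ⟶ end_ (E.obj d) :=
  end_.lift (fun j ↦ (K.ι j).app d x) (fun _ _ g ↦ congr(($(K.condition (Arrow.mk g))).app d x))

lemma endCoyonedaLift_π (E : D ⥤ Jᵒᵖ ⥤ J ⥤ C) (G : C) (K : Multifork (endCoyonedaIndex E G))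
    (d : D) (x : K.pt.obj d) (j : J) :
    endCoyonedaLift E G K d x ≫ end_.π (E.obj d) j = (K.ι j).app d x :=
  end_.lift_π _ _ _

/-- The multifork `endCoyonedaFork` is a limit. -/
def isLimitEndCoyonedaFork (E : D ⥤ Jᵒᵖ ⥤ J ⥤ C) (G : C) :
    IsLimit (endCoyonedaFork E G) :=
  Multifork.IsLimit.mk _
    (fun K ↦
      { app d := ↾endCoyonedaLift E G K d
        naturality d d' f := by
          ext x
          have : endCoyonedaLift E G K d' (K.pt.map f x) =
              endCoyonedaLift E G K d x ≫ end_.map (E.map f) := by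
            refine end_.hom_ext fun j ↦ ?_
            rw [endCoyonedaLift_π, Category.assoc, end_.map_π, ← Category.assoc,
              endCoyonedaLift_π]
            exact congr($((K.ι j).naturality f) x)
          exact this })
    (fun K j ↦ by
      ext d x
      exact endCoyonedaLift_π E G K d x j)
    (fun K m hm ↦ by
      ext d x
      refine end_.hom_ext (F := E.obj d) fun j ↦ ?_
      exact Eq.trans congr(($(hm j)).app d x) (endCoyonedaLift_π E G K d x j).symm)

/-- Ends over a finite category commute with filtered colimits in a locally finitely presentable
category. -/
lemma isFinitelyAccessible_comp_endFunctor [IsLocallyFinitelyPresentable.{v} C] [FinCategory J]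
    (E : D ⥤ Jᵒᵖ ⥤ J ⥤ C)
    (hE : ∀ j k : J, Functor.IsFinitelyAccessible.{v}
      (E ⋙ (evaluation _ _).obj (op j) ⋙ (evaluation _ _).obj k)) :
    Functor.IsFinitelyAccessible.{v} (E ⋙ endFunctor J C) := by
  -- After applying Hom(G, -), the end becomes a finite limit of set-valued functors, and in sets
  -- finite limits commute with filtered colimits.
  refine isFinitelyAccessible_of_coyoneda _ fun G hG ↦ ?_
  have hG' : (coyoneda.obj (op G)).IsCardinalAccessible ℵ₀ := hG
  have hK : HasCardinalLT (Arrow (WalkingMulticospan (multicospanShapeEnd J))) ℵ₀ := by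
    classical
    rw [hasCardinalLT_aleph0_iff]
    let : Fintype (multicospanShapeEnd J).L := inferInstanceAs (Fintype J)
    let : Fintype (multicospanShapeEnd J).R := Fintype.ofFinite (Arrow J)
    let : DecidableEq (multicospanShapeEnd J).L := Classical.decEq _
    let : DecidableEq (multicospanShapeEnd J).R := Classical.decEq _
    infer_instance
  have : ∀ k, (((endCoyonedaIndex E G).multicospan).obj k).IsCardinalAccessible ℵ₀ := by
    rintro (j | f)
    · have := hE j j
      exact inferInstanceAs (((E ⋙ (evaluation _ _).obj (op j) ⋙ (evaluation _ _).obj j) ⋙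
        coyoneda.obj (op G)).IsCardinalAccessible ℵ₀)
    · have := hE f.left f.right
      exact inferInstanceAs (((E ⋙ (evaluation _ _).obj (op f.left) ⋙
        (evaluation _ _).obj f.right) ⋙ coyoneda.obj (op G)).IsCardinalAccessible ℵ₀)
  exact Functor.isCardinalAccessible_of_isLimit _ (isLimitEndCoyonedaFork E G) ℵ₀ hK

end FilteredColimits

/-! ### Homotopy limits and filtered colimits -/

section HolimFilteredColimits

open Cardinal

attribute [local instance] fact_isRegular_aleph0

variable {C : Type u} [Category.{v} C] [SimplicialCategory C] [TensoredCotensored C]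
  [IsLocallyFinitelyPresentable.{v} C]

/-- By adjunction, Hom(G, Y ^ K) = Hom(K ⊗ G, Y), and K ⊗ G is again finitely presentable. -/
lemma isFinitelyAccessible_cotensor
    (tensor_fp : ∀ (K : SSet.{v}) (X : C), IsFinitelyPresentable.{v} K →
      IsFinitelyPresentable.{v} X →
      IsFinitelyPresentable.{v} ((TensoredCotensored.tensor.obj K).obj X))
    (K : SSet.{v}) (hK : IsFinitelyPresentable.{v} K) :
    Functor.IsFinitelyAccessible.{v} (TensoredCotensored.cotensor (C := C).obj (op K)) := by
  refine isFinitelyAccessible_of_coyoneda _ fun G hG ↦ ?_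
  have := (isCardinalPresentable_iff_isCardinalAccessible_coyoneda_obj ..).1 (tensor_fp K G hK hG)
  exact Functor.isCardinalAccessible_of_natIso (coyonedaTensorIso K G) ℵ₀

lemma isFinitelyAccessible_holim [ModelCategory C] [IsSimplicialModelCategory C]
    (tensor_fp : ∀ (K : SSet.{v}) (X : C), IsFinitelyPresentable.{v} K →
      IsFinitelyPresentable.{v} X →
      IsFinitelyPresentable.{v} ((TensoredCotensored.tensor.obj K).obj X))
    (J : Type v) [SmallCategory J] [FinCategory J]
    (nerve_fp : ∀ j : J, IsFinitelyPresentable.{v} (nerve (Over j))) :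
    Functor.IsFinitelyAccessible.{v} (holim C J) := by
  refine isFinitelyAccessible_comp_endFunctor _ fun j k ↦ ?_
  have := isFinitelyAccessible_cotensor tensor_fp _ (nerve_fp j)
  exact inferInstanceAs (((evaluation J C).obj k ⋙
    TensoredCotensored.cotensor.obj (op (nerve (Over j)))).IsCardinalAccessible ℵ₀)

end HolimFilteredColimits

/-! ### The relative nerve -/

section RelativeNerve

variable {J : Type v} [SmallCategory J]

/-- The action of a morphism `f : j ⟶ k` on the simplices of `E j`. -/
def push (E : J ⥤ SSet.{v}) {j k : J} (f : j ⟶ k) {m : SimplexCategoryᵒᵖ}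
    (a : (E.obj j).obj m) : (E.obj k).obj m :=
  (E.map f).app m a

@[simp]
lemma push_id (E : J ⥤ SSet.{v}) {j : J} {m : SimplexCategoryᵒᵖ} (a : (E.obj j).obj m) :
    push E (𝟙 j) a = a := by
  simp [push]

@[simp]
lemma push_push (E : J ⥤ SSet.{v}) {j k l : J} (f : j ⟶ k) (g : k ⟶ l) {m : SimplexCategoryᵒᵖ}
    (a : (E.obj j).obj m) : push E g (push E f a) = push E (f ≫ g) a := by
  simp [push]

lemma map_push (E : J ⥤ SSet.{v}) {j k : J} (f : j ⟶ k) {m m' : SimplexCategoryᵒᵖ} (θ : m ⟶ m')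
    (a : (E.obj j).obj m) : (E.obj k).map θ (push E f a) = push E f ((E.obj j).map θ a) :=
  (NatTrans.naturality_apply (E.map f) θ a).symm

lemma app_push {E B : J ⥤ SSet.{v}} (p : E ⟶ B) {j k : J} (f : j ⟶ k) {m : SimplexCategoryᵒᵖ}
    (a : (E.obj j).obj m) :
    (p.app k).app m (push E f a) = push B f ((p.app j).app m a) :=
  congr(($(p.naturality f)).app m a)

/-- The image of the last vertex under a map of simplices. -/
def top {m n : SimplexCategory} (x : m ⟶ n) : Fin (n.len + 1) :=
  x.toOrderHom (Fin.last m.len)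

lemma top_comp_le {k m n : SimplexCategory} (y : k ⟶ m) (x : m ⟶ n) : top (y ≫ x) ≤ top x :=
  x.toOrderHom.monotone (Fin.le_last _)

/-- A simplex of the relative nerve of `E : J ⥤ SSet`: a chain `c` of composable arrows in `J`,
together with a compatible family which sends every face `x` of the chain to a simplex of the value
of `E` at the last vertex of that face. -/
structure RelSimplex (E : J ⥤ SSet.{v}) (n : SimplexCategory) where
  chain : ComposableArrows J n.len
  val {m : SimplexCategory} (x : m ⟶ n) : (E.obj (chain.obj (top x))).obj (op m)
  map_val {k m : SimplexCategory} (y : k ⟶ m) (x : m ⟶ n) :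
    (E.obj (chain.obj (top x))).map y.op (val x) =
      push E (chain.map (homOfLE (top_comp_le y x))) (val (y ≫ x))

/-- The restriction of a chain along a map of simplices. -/
abbrev restrChain {m n : SimplexCategory} (θ : m ⟶ n) (c : ComposableArrows J n.len) :
    ComposableArrows J m.len :=
  (nerve J).map θ.op c

namespace RelSimplex

variable {E B : J ⥤ SSet.{v}}

lemma map_val_of_eq {k m n : SimplexCategory} (z : RelSimplex E n) {y : k ⟶ m} {x : m ⟶ n}
    {x' : k ⟶ n} (h : y ≫ x = x') (h' : top x' ≤ top x) :
    (E.obj (z.chain.obj (top x))).map y.op (z.val x) =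
      push E (z.chain.map (homOfLE h')) (z.val x') := by
  subst h
  exact z.map_val y x

/-- The restriction of a simplex of the relative nerve. -/
@[simps]
def restr {m n : SimplexCategory} (θ : m ⟶ n) (z : RelSimplex E n) : RelSimplex E m where
  chain := restrChain θ z.chain
  val x := z.val (x ≫ θ)
  map_val y x := z.map_val y (x ≫ θ)

/-- The image of a simplex of the relative nerve under a natural transformation. -/
@[simps]
def mapVal (p : E ⟶ B) {n : SimplexCategory} (z : RelSimplex E n) : RelSimplex B n where
  chain := z.chain
  val x := (p.app _).app _ (z.val x)
  map_val y x := by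
    rw [← app_push, ← z.map_val y x]
    exact (NatTrans.naturality_apply (p.app _) y.op (z.val x)).symm

/-- The last value of a simplex of the relative nerve whose chain is equal to `c`. -/
def lastVal {n : SimplexCategory} (z : RelSimplex E n) (c : ComposableArrows J n.len)
    (h : z.chain = c) : (E.obj (c.obj (Fin.last _))).obj (op n) :=
  push E (eqToHom (by rw [← h]; rfl)) (z.val (𝟙 n))

@[simp]
lemma lastVal_self {n : SimplexCategory} (z : RelSimplex E n) :
    z.lastVal z.chain rfl = z.val (𝟙 n) :=
  push_id E _

lemma lastVal_restr {m n : SimplexCategory} (z : RelSimplex E n) (θ : m ⟶ n) :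
    (z.restr θ).lastVal (restrChain θ z.chain) rfl = z.val θ := by
  have (x : m ⟶ n) (hx : x = θ) (h) : push E (eqToHom h) (z.val x) = z.val θ := by
    subst hx
    exact push_id E _
  exact this _ (Category.id_comp θ) _

lemma map_lastVal {m n : SimplexCategory} (z : RelSimplex E n) (θ : m ⟶ n)
    (c : ComposableArrows J n.len) (h : z.chain = c) {z' : RelSimplex E m} (hz : z' = z.restr θ) :
    (E.obj _).map θ.op (z.lastVal c h) =
      push E (c.map (homOfLE (Fin.le_last (top θ))))
        (z'.lastVal (restrChain θ c) (by rw [hz, ← h]; rfl)) := by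
  subst h hz
  rw [lastVal_self, lastVal_restr]
  exact z.map_val_of_eq (Category.comp_id θ) (Fin.le_last (top θ))

lemma app_lastVal {n : SimplexCategory} (p : E ⟶ B) (z : RelSimplex E n)
    (c : ComposableArrows J n.len) (h : z.chain = c) {w : RelSimplex B n} (hw : w = z.mapVal p) :
    (p.app _).app _ (z.lastVal c h) = w.lastVal c (by rw [hw, ← h]; rfl) := by
  subst h hw
  rw [lastVal_self]
  exact (push_id B _).symm

/-- The types of the values depend on the chain. Moving both simplices over one chain `c` by
`lastVal` avoids heterogeneous equalities, and nothing is lost since each value is the last value of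
a restriction. -/
lemma ext_of_lastVal {n : SimplexCategory} {z z' : RelSimplex E n} (c : ComposableArrows J n.len)
    (h : z.chain = c) (h' : z'.chain = c)
    (H : ∀ {m : SimplexCategory} (x : m ⟶ n),
      (z.restr x).lastVal (restrChain x c) (by rw [← h]; rfl) =
        (z'.restr x).lastVal (restrChain x c) (by rw [← h']; rfl)) : z = z' := by
  obtain ⟨c, a, ha⟩ := z
  obtain ⟨c', a', ha'⟩ := z'
  dsimp at h h'
  subst h h'
  congr
  funext m x
  have := H x
  erw [lastVal_restr, lastVal_restr] at this
  exact this

lemma restr_id {n : SimplexCategory} (z : RelSimplex E n) : z.restr (𝟙 n) = z := by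
  refine ext_of_lastVal z.chain rfl rfl fun {m} x ↦ ?_
  have : (z.restr (𝟙 n)).restr x = z.restr x := by
    change z.restr (x ≫ 𝟙 n) = z.restr x
    rw [Category.comp_id]
  simp only [this]

end RelSimplex

/-- The relative nerve of a functor `E : J ⥤ SSet`. -/
def relNerve (E : J ⥤ SSet.{v}) : SSet.{v} where
  obj n := RelSimplex E n.unop
  map θ := ↾RelSimplex.restr θ.unop
  map_id n := by
    ext z
    exact z.restr_id

/-- The functoriality of the relative nerve. -/
def relNerveMap {E B : J ⥤ SSet.{v}} (p : E ⟶ B) : relNerve E ⟶ relNerve B where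
  app n := ↾RelSimplex.mapVal p

end RelativeNerve

/-! ### Extending partial simplices of the relative nerve -/

section RelativeNerveLifting

open Simplicial

variable {J : Type v} [SmallCategory J] {E B : J ⥤ SSet.{v}} {p : E ⟶ B} {n : SimplexCategory}

namespace RelSimplex

/-- The family of last values of simplices of the relative nerve over the faces of a chain `c`
which satisfy `P`. -/
structure PartialSimplex (E : J ⥤ SSet.{v}) {n : SimplexCategory} (c : ComposableArrows J n.len)
    (P : ∀ ⦃m : SimplexCategory⦄, (m ⟶ n) → Prop) where
  val {m : SimplexCategory} (x : m ⟶ n) (hx : P x) : (E.obj (c.obj (top x))).obj (op m)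
  map_val {k m : SimplexCategory} (y : k ⟶ m) (x : m ⟶ n) (hx : P x) (hyx : P (y ≫ x)) :
    (E.obj (c.obj (top x))).map y.op (val x hx) =
      push E (c.map (homOfLE (top_comp_le y x))) (val (y ≫ x) hyx)

open Classical in
/-- The simplex of the relative nerve which extends a family `a` defined over proper faces by
a map `l` from the standard simplex to the last value of `E`. -/
def extend {c : ComposableArrows J n.len} {P : ∀ ⦃m : SimplexCategory⦄, (m ⟶ n) → Prop}
    (hP : ∀ ⦃m : SimplexCategory⦄ (x : m ⟶ n), top x ≠ Fin.last _ → P x)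
    (a : PartialSimplex E c P) (t : (E.obj (c.obj (Fin.last _))).obj (op n))
    (ht : ∀ ⦃m : SimplexCategory⦄ (x : m ⟶ n) (hx : P x), (E.obj _).map x.op t =
      push E (c.map (homOfLE (Fin.le_last (top x)))) (a.val x hx)) :
    RelSimplex E n where
  chain := c
  -- A face ending at the last vertex takes its value from `t`, up to transport along an identity;
  -- any other face satisfies `P`.
  val x := if h : top x = Fin.last _ then
      push E (c.map (homOfLE h.ge)) ((E.obj _).map x.op t)
    else a.val x (hP x h)
  map_val {k m} y x := by
    by_cases h : top x = Fin.last _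
    · rw [dif_pos h, map_push]
      have h₂ : (E.obj (c.obj (Fin.last _))).map y.op ((E.obj _).map x.op t) =
        (E.obj _).map (y ≫ x).op t := by simp
      rw [h₂]
      by_cases h' : top (y ≫ x) = Fin.last _
      · rw [dif_pos h', push_push, ← Functor.map_comp]
        rfl
      · rw [dif_neg h', ht _ (hP _ h'), push_push, ← Functor.map_comp]
        rfl
    · have h' : top (y ≫ x) ≠ Fin.last _ := fun h' ↦
        h (le_antisymm (Fin.le_last _) (h'.ge.trans (top_comp_le y x)))
      rw [dif_neg h, dif_neg h']
      exact a.map_val y x _ _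

variable {c : ComposableArrows J n.len} {P : ∀ ⦃m : SimplexCategory⦄, (m ⟶ n) → Prop}
    (hP : ∀ ⦃m : SimplexCategory⦄ (x : m ⟶ n), top x ≠ Fin.last _ → P x)
    (a : PartialSimplex E c P) (t : (E.obj (c.obj (Fin.last _))).obj (op n))
    (ht : ∀ ⦃m : SimplexCategory⦄ (x : m ⟶ n) (hx : P x), (E.obj _).map x.op t =
      push E (c.map (homOfLE (Fin.le_last (top x)))) (a.val x hx))

lemma extend_val {m : SimplexCategory} (x : m ⟶ n) (hx : P x) :
    (extend hP a t ht).val x = a.val x hx := by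
  by_cases h : top x = Fin.last _
  · refine (dif_pos h).trans ?_
    rw [ht x hx, push_push, ← Functor.map_comp]
    exact (congrArg (fun f ↦ push E f (a.val x hx)) (c.map_id _)).trans (push_id E _)
  · exact dif_neg h

/-- On faces in `P` this is `hza`. Any other face ends at the last vertex, so its value is a
restriction of `t`, and `hzt` applies. -/
lemma app_extend_val {z : RelSimplex B n} (hz : z.chain = c)
    (hzt : (p.app _).app _ t = z.lastVal c hz)
    (hza : ∀ ⦃m : SimplexCategory⦄ (x : m ⟶ n) (hx : P x), (p.app _).app _ (a.val x hx) =
      (z.restr x).lastVal (restrChain x c) (by rw [← hz]; rfl)) :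
    (extend hP a t ht).mapVal p = z := by
  subst hz
  refine ext_of_lastVal _ rfl rfl fun {m} x ↦ ?_
  erw [lastVal_restr, lastVal_restr]
  suffices h : (p.app (z.chain.obj (top x))).app (op m)
      (show (E.obj (z.chain.obj (top x))).obj (op m) from (extend hP a t ht).val x) = z.val x from h
  by_cases h : P x
  · rw [extend_val hP a t ht x h, hza x h, lastVal_restr]
  · have h₁ : top x = Fin.last _ := by
      by_contra h'
      exact h (hP x h')
    have h₂ : (extend hP a t ht).val x =
        push E (z.chain.map (homOfLE h₁.ge)) ((E.obj _).map x.op t) := dif_pos h₁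
    have h₃ : (p.app (z.chain.obj (Fin.last _))).app (op m) ((E.obj _).map x.op t) =
        (B.obj _).map x.op ((p.app _).app _ t) := NatTrans.naturality_apply (p.app _) x.op t
    have h₄ : (B.obj (z.chain.obj (Fin.last _))).map x.op (z.val (𝟙 n)) =
      push B (z.chain.map (homOfLE (Fin.le_last (top x)))) (z.val x) :=
        z.map_val_of_eq (Category.comp_id x) (Fin.le_last (top x))
    rw [h₂, app_push, h₃, hzt, lastVal_self]
    refine (congrArg (push B _) h₄).trans ?_
    rw [push_push, ← Functor.map_comp]
    exact (congrArg (fun f ↦ push B f (z.val x)) (z.chain.map_id _)).trans (push_id B _)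

end RelSimplex

end RelativeNerveLifting

/-! ### The relative nerve and trivial Kan fibrations -/

section RelativeNerveFibration

open Simplicial SSet

variable {J : Type v} [SmallCategory J] {E B : J ⥤ SSet.{v}} {p : E ⟶ B}

namespace RelSimplex

/-- The faces of the standard simplex which belong to the boundary. -/
def IsBoundary {n : ℕ} ⦃m : SimplexCategory⦄ (x : m ⟶ ⦋n⦌) : Prop :=
  stdSimplex.objEquiv.{v}.symm x ∈ (boundary.{v} n).obj (op m)

/-- A monotone map that attains the last vertex does so at its last argument, so here `x` is not
surjective. -/
lemma isBoundary_of_top_ne {n : ℕ} ⦃m : SimplexCategory⦄ (x : m ⟶ ⦋n⦌)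
    (hx : top x ≠ Fin.last _) : IsBoundary.{v} x := by
  intro h
  obtain ⟨i, hi⟩ := h (Fin.last _)
  refine hx (le_antisymm (Fin.le_last _) ?_)
  have : x.toOrderHom i = Fin.last n := hi
  change Fin.last n ≤ x.toOrderHom (Fin.last _)
  rw [← this]
  exact x.toOrderHom.monotone (Fin.le_last i)

variable {n : ℕ} {u : (boundary.{v} n : SSet.{v}) ⟶ relNerve E} {w : Δ[n] ⟶ relNerve B}

/-- The simplex of the relative nerve corresponding to a map from the standard simplex. -/
def ofSimplex (w : Δ[n] ⟶ relNerve B) : RelSimplex B ⦋n⦌ := yonedaEquiv w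

/-- The simplex of the relative nerve attached to a face of the boundary. -/
def ofBoundary (u : (boundary.{v} n : SSet.{v}) ⟶ relNerve E) {m : SimplexCategory}
    (x : m ⟶ ⦋n⦌) (hx : IsBoundary.{v} x) : RelSimplex E m :=
  u.app (op m) ⟨_, hx⟩

lemma ofBoundary_comp {k m : SimplexCategory} (y : k ⟶ m) (x : m ⟶ ⦋n⦌) (hx : IsBoundary.{v} x)
    (hyx : IsBoundary.{v} (y ≫ x)) : ofBoundary u (y ≫ x) hyx = (ofBoundary u x hx).restr y :=
  NatTrans.naturality_apply u y.op (⟨_, hx⟩ : (boundary.{v} n).obj (op m))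

lemma mapVal_ofBoundary (sq : CommSq u (boundary.{v} n).ι (relNerveMap p) w)
    {m : SimplexCategory} (x : m ⟶ ⦋n⦌) (hx : IsBoundary.{v} x) :
    (ofBoundary u x hx).mapVal p =
      (ofSimplex w).restr x := by
  have h₁ := congr(($(sq.w)).app (op m) ⟨_, hx⟩)
  refine h₁.trans ?_
  have h₂ : w.app (op m) (stdSimplex.objEquiv.symm x) = (relNerve B).map x.op (yonedaEquiv w) := by
    conv_lhs => rw [← yonedaEquiv.symm_apply_apply w]
    rfl
  exact h₂

/-- The partial simplex given by a map from the boundary to the relative nerve. -/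
def partialOfBoundary (sq : CommSq u (boundary.{v} n).ι (relNerveMap p) w) :
    PartialSimplex E (ofSimplex w).chain IsBoundary.{v} where
  val x hx := (ofBoundary u x hx).lastVal (restrChain x _)
    (congrArg RelSimplex.chain (mapVal_ofBoundary sq x hx))
  map_val y x hx hyx := map_lastVal (ofBoundary u x hx) y (restrChain x _)
    (congrArg RelSimplex.chain (mapVal_ofBoundary sq x hx)) (ofBoundary_comp y x hx hyx)

lemma app_partialOfBoundary (sq : CommSq u (boundary.{v} n).ι (relNerveMap p) w)
    {m : SimplexCategory} (x : m ⟶ ⦋n⦌) (hx : IsBoundary.{v} x) :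
    (p.app _).app _ ((partialOfBoundary sq).val x hx) =
      (ofSimplex w).val x :=
  (app_lastVal p (ofBoundary u x hx) (restrChain x _)
    (congrArg RelSimplex.chain (mapVal_ofBoundary sq x hx))
    (mapVal_ofBoundary sq x hx).symm).trans (lastVal_restr _ x)

/-- The map from the boundary to the last value of `E`. -/
def boundaryToLast (sq : CommSq u (boundary.{v} n).ι (relNerveMap p) w) :
    (boundary.{v} n : SSet.{v}) ⟶
      E.obj ((ofSimplex w).chain.obj (Fin.last _)) where
  app m := ↾fun s ↦ push E ((ofSimplex w).chain.map (homOfLE (Fin.le_last (top (stdSimplex.objEquiv s.1)))))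
    ((partialOfBoundary sq).val (stdSimplex.objEquiv s.1) s.2)
  naturality m m' θ := by
    ext s
    have h := (partialOfBoundary sq).map_val θ.unop (stdSimplex.objEquiv s.1) s.2
      ((boundary.{v} n).map θ s.2)
    have h' := map_push E (((ofSimplex w).chain).map
      (homOfLE (Fin.le_last (top (stdSimplex.objEquiv s.1))))) θ
        ((partialOfBoundary sq).val (stdSimplex.objEquiv s.1) s.2)
    refine Eq.trans ?_ h'.symm
    refine Eq.trans ?_ (congrArg (push E _) h.symm)
    rw [push_push, ← Functor.map_comp]
    rfl

lemma commSq_boundaryToLast (sq : CommSq u (boundary.{v} n).ι (relNerveMap p) w) :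
    CommSq (boundaryToLast sq) (boundary.{v} n).ι (p.app _)
      (yonedaEquiv.symm ((ofSimplex w).val (𝟙 _))) where
  w := by
    ext m s
    refine Eq.trans (app_push p ((ofSimplex w).chain.map (homOfLE (Fin.le_last
      (top (stdSimplex.objEquiv s.1))))) ((partialOfBoundary sq).val _ s.2)) ?_
    refine (congrArg (push B _) (app_partialOfBoundary sq _ s.2)).trans ?_
    exact ((ofSimplex w).map_val_of_eq
      (Category.comp_id (stdSimplex.objEquiv s.1)) (Fin.le_last _)).symm

end RelSimplex

open RelSimplex

/-- The relative nerve sends objectwise trivial Kan fibrations to trivial Kan fibrations. -/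
lemma rlp_relNerveMap (hp : ∀ j, modelCategoryQuillen.I.{v}.rlp (p.app j)) :
    modelCategoryQuillen.I.{v}.rlp (relNerveMap p) := by
  rintro _ _ _ ⟨n⟩
  refine ⟨fun {u w} sq ↦ ?_⟩
  -- Pushing all boundary values to the last object of the chain yields a single map ∂Δ[n] ⟶ E(c_n),
  -- so one lift against `p` at that object provides the missing value `t`.
  have := hp ((ofSimplex w).chain.obj (Fin.last _)) _
    (modelCategoryQuillen.boundary_ι_mem_I n)
  have sq' := commSq_boundaryToLast sq
  let t := yonedaEquiv sq'.lift
  have ht ⦃m : SimplexCategory⦄ (x : m ⟶ ⦋n⦌) (hx : IsBoundary.{v} x) :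
      (E.obj _).map x.op t = push E ((ofSimplex w).chain.map (homOfLE (Fin.le_last (top x))))
        ((partialOfBoundary sq).val x hx) := by
    have h₁ := congr(($(sq'.fac_left)).app (op m) ⟨_, hx⟩)
    refine Eq.trans ?_ h₁
    have h₂ : sq'.lift.app (op m) (stdSimplex.objEquiv.symm x) =
        (E.obj _).map x.op (yonedaEquiv sq'.lift) := by
      conv_lhs => rw [← yonedaEquiv.symm_apply_apply sq'.lift]
      rfl
    exact h₂.symm
  have hzt : (p.app _).app _ t =
      (ofSimplex w).lastVal _ rfl := by
    rw [lastVal_self]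
    have h₁ := congr(yonedaEquiv $(sq'.fac_right))
    exact h₁.trans (Equiv.apply_symm_apply _ _)
  let α := extend isBoundary_of_top_ne (partialOfBoundary sq) t ht
  refine ⟨⟨⟨yonedaEquiv.symm (show (relNerve E).obj (op ⦋n⦌) from α), ?_, ?_⟩⟩⟩
  · ext m s
    refine ext_of_lastVal (restrChain (stdSimplex.objEquiv s.1) _) rfl
      (congrArg RelSimplex.chain (mapVal_ofBoundary sq (stdSimplex.objEquiv s.1) s.2))
      fun {k} y ↦ ?_
    have hy : IsBoundary.{v} (y ≫ stdSimplex.objEquiv s.1) := (boundary.{v} n).map y.op s.2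
    refine (lastVal_restr α (y ≫ stdSimplex.objEquiv s.1)).trans ?_
    refine (extend_val isBoundary_of_top_ne (partialOfBoundary sq) t ht _ hy).trans ?_
    have := ofBoundary_comp (u := u) y (stdSimplex.objEquiv s.1) s.2 hy
    dsimp only [partialOfBoundary]
    simp only [this]
    rfl
  · refine yonedaEquiv.injective ?_
    rw [yonedaEquiv_symm_comp, Equiv.apply_symm_apply]
    exact app_extend_val isBoundary_of_top_ne (partialOfBoundary sq) t ht rfl hzt
      fun m x hx ↦ (app_partialOfBoundary sq x hx).trans (lastVal_restr _ x).symm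

end RelativeNerveFibration

/-! ### Projective cofibrancy of the nerves of over categories -/

section NerveOver

open SSet

variable {J : Type v} [SmallCategory J] {E B : J ⥤ SSet.{v}}

/-- The chain of objects over `j` given by a chain `c` and a morphism from its last vertex to `j`. -/
def overChain {n : ℕ} (c : ComposableArrows J n) {j : J} (f : c.obj (Fin.last n) ⟶ j) :
    ComposableArrows (Over j) n where
  obj i := Over.mk (c.map (homOfLE (Fin.le_last i)) ≫ f)
  map g := Over.homMk (c.map g) (by
    dsimp
    rw [← Functor.map_comp_assoc]
    rfl)

lemma eq_of_heq_left {j : J} {a a' b b' : Over j} (ha : a = a') (hb : b = b') {f : a ⟶ b}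
    {f' : a' ⟶ b'} (h : HEq f.left f'.left) : f = eqToHom ha ≫ f' ≫ eqToHom hb.symm := by
  subst ha hb
  ext
  simpa using h

/-- All structure maps of a chain over `j` are determined by the last one, through `Over.w`. -/
lemma overChain_eq {n : ℕ} {j : J} (y : ComposableArrows (Over j) n) :
    overChain (y ⋙ Over.forget j) (y.obj (Fin.last n)).hom = y :=
  have h (i : Fin (n + 1)) : (overChain (y ⋙ Over.forget j) (y.obj (Fin.last n)).hom).obj i =
      y.obj i := congrArg Over.mk (Over.w (y.map (homOfLE (Fin.le_last i))))
  CategoryTheory.Functor.ext h (fun i i' _ ↦ eq_of_heq_left (h i) (h i') HEq.rfl)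

lemma eq_overChain {n : ℕ} {j : J} (y : ComposableArrows (Over j) n) (c : ComposableArrows J n)
    (f : c.obj (Fin.last n) ⟶ j) (h : y ⋙ Over.forget j = c)
    (hf : (y.obj (Fin.last n)).hom = eqToHom (by rw [← h]; rfl) ≫ f) : y = overChain c f := by
  subst h
  have hf' : (y.obj (Fin.last n)).hom = f := hf.trans (Category.id_comp f)
  rw [← hf', overChain_eq]

lemma map_overChain {n : ℕ} (c : ComposableArrows J n) {j k : J} (f : c.obj (Fin.last n) ⟶ j)
    (g : j ⟶ k) :
    ((nerveOver J).map g).app (op (SimplexCategory.mk n)) (overChain c f) =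
      overChain c (f ≫ g) := by
  refine eq_overChain (n := n) (((nerveOver J).map g).app (op (SimplexCategory.mk n)) _) c _ rfl ?_
  refine Eq.trans ?_ (Category.id_comp _).symm
  have : (c.map (𝟙 _) ≫ f) ≫ g = f ≫ g := by simp
  exact this

lemma restr_overChain {m n : SimplexCategory} (θ : m ⟶ n) (c : ComposableArrows J n.len) {j : J}
    (f : c.obj (Fin.last _) ⟶ j) :
    (nerve (Over j)).map θ.op (overChain c f) =
      overChain (restrChain θ c) (c.map (homOfLE (Fin.le_last (top θ))) ≫ f) :=
  eq_overChain (n := m.len) ((nerve (Over j)).map θ.op _) (restrChain θ c) _ rfl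
    (Category.id_comp _).symm

/-- The simplex of the relative nerve determined by a chain in `J` and a natural transformation
from the nerves of the over categories. -/
def simplexOfNat (b : nerveOver J ⟶ B) {n : SimplexCategory} (c : ComposableArrows J n.len) :
    RelSimplex B n where
  chain := c
  val {m} x := (b.app (c.obj (top x))).app (op m) (overChain (restrChain x c) (𝟙 _))
  map_val {k m} y x := by
    refine (NatTrans.naturality_apply (b.app (c.obj (top x))) y.op _).symm.trans ?_
    refine Eq.trans ?_ (app_push b (c.map (homOfLE (top_comp_le y x))) _)
    refine congrArg _ ?_
    refine (restr_overChain y (restrChain x c) (𝟙 _)).trans ?_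
    refine Eq.trans ?_ (map_overChain (restrChain (y ≫ x) c) (𝟙 _) _).symm
    exact congrArg (overChain (restrChain (y ≫ x) c))
      ((Category.comp_id _).trans (Category.id_comp _).symm)

/-- The map to the relative nerve determined by a natural transformation from the nerves of the
over categories. -/
def nerveToRelNerve (b : nerveOver J ⟶ B) : nerve J ⟶ relNerve B where
  app n := ↾fun c ↦ simplexOfNat b (n := n.unop) c
  naturality n m θ := by
    ext c
    rfl

variable (s : nerve J ⟶ relNerve E)
    (hs : ∀ (n : SimplexCategory) (c : ComposableArrows J n.len),
      RelSimplex.chain (n := n) (s.app (op n) c) = c)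

/-- The natural transformation from the nerves of the over categories determined by a section of the
relative nerve. -/
def natOfSection : nerveOver J ⟶ E where
  app j :=
    -- The section gives a value at the last object of the underlying chain; the structure map of
    -- that object pushes it to `j`.
    { app n := ↾fun y ↦ push E (y.obj (Fin.last _)).hom
        (RelSimplex.lastVal (n := n.unop) (s.app n (y ⋙ Over.forget j)) _ (hs _ _))
      naturality n m θ := by
        ext (y : ComposableArrows (Over j) n.unop.len)
        have h := RelSimplex.map_lastVal (n := n.unop) (s.app n (y ⋙ Over.forget j)) θ.unop _
          (hs _ _) (NatTrans.naturality_apply s θ _)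
        refine Eq.trans ?_ (map_push E _ θ _).symm
        refine Eq.trans ?_ (congrArg (push E _) h.symm)
        refine Eq.trans ?_ (push_push E _ _ _).symm
        refine congrArg (fun f ↦ push E f _) ?_
        exact (Over.w (y.map (homOfLE (Fin.le_last (top θ.unop))))).symm }
  naturality j k g := by
    ext n y
    exact (push_push E _ _ _).symm

/-- The functor `j ↦ N(J ↓ j)` has the left lifting property with respect to objectwise trivial Kan
fibrations. -/
lemma exists_lift_nerveOver {p : E ⟶ B} (hp : ∀ j, modelCategoryQuillen.I.{v}.rlp (p.app j))
    (b : nerveOver J ⟶ B) : ∃ e : nerveOver J ⟶ E, e ≫ p = b := by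
  have hp' := rlp_relNerveMap hp
  rw [← rlp_monomorphisms] at hp'
  -- A trivial Kan fibration lifts against every monomorphism, in particular ∅ ⟶ N(J).
  have := hp' (⊥ : (nerve J).Subcomplex).ι (MorphismProperty.monomorphisms.infer_property _)
  have sq : CommSq (Subcomplex.isInitialBot.to (relNerve E)) (⊥ : (nerve J).Subcomplex).ι
    (relNerveMap p) (nerveToRelNerve b) := ⟨Subcomplex.isInitialBot.hom_ext _ _⟩
  have h (n : SimplexCategory) (c : ComposableArrows J n.len) :
    RelSimplex.mapVal p (n := n) (sq.lift.app (op n) c) = simplexOfNat b c :=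
      congr(($(sq.fac_right)).app (op n) c)
  refine ⟨natOfSection sq.lift (fun n c ↦ congrArg RelSimplex.chain (h n c)), ?_⟩
  ext j n (y : ComposableArrows (Over j) n.unop.len)
  refine (app_push p (y.obj (Fin.last _)).hom _).trans ?_
  refine (congrArg (push B _) (RelSimplex.app_lastVal (n := n.unop) p _ (y ⋙ Over.forget j) _
    (h _ _).symm)).trans ?_
  refine (congrArg (push B _) (RelSimplex.lastVal_self
    (simplexOfNat b (n := n.unop) (y ⋙ Over.forget j)))).trans ?_
  -- By naturality of `b` the push can be done on chains, where it turns the chain ending in an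
  -- identity back into `y`.
  refine (app_push b (y.obj (Fin.last _)).hom _).symm.trans ?_
  refine congrArg ((b.app j).app n) ?_
  refine (map_overChain (n := n.unop.len) _ _ _).trans ?_
  exact (eq_overChain (n := n.unop.len) y _ _ (congr($((nerve J).map_id n) _)).symm
    ((Category.id_comp _).trans (Category.id_comp _)).symm).symm

end NerveOver

/-! ### Homotopy limits of trivial fibrations -/

section HomHolim

/-- Needed because a pullback of diagrams evaluated at `j` is only isomorphic to the chosen pullback
in `cornerMap`. -/
lemma rlp_of_isPullback {D : Type*} [Category* D] {T : MorphismProperty D} {W P X Y Z : D}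
    {fst : P ⟶ X} {snd : P ⟶ Y} {f : X ⟶ Z} {g : Y ⟶ Z} [HasPullback f g]
    (h : IsPullback fst snd f g) (l : W ⟶ P) {m : W ⟶ pullback f g} (hm : T.rlp m)
    (h₁ : l ≫ fst = m ≫ pullback.fst f g) (h₂ : l ≫ snd = m ≫ pullback.snd f g) : T.rlp l := by
  have : l = m ≫ h.isoPullback.inv := by
    apply h.hom_ext
    · simpa using h₁
    · simpa using h₂
  rw [this]
  exact MorphismProperty.RespectsIso.postcomp _ _ _ hm

variable {C : Type u} [Category.{v} C] [ModelCategory C] [SimplicialCategory C]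
  [TensoredCotensored C] [IsSimplicialModelCategory C] {J : Type v} [SmallCategory J]

/-- The diagram `j ↦ Map(A, X j)`. -/
abbrev mapDiagram (A : C) (X : J ⥤ C) : J ⥤ SSet.{v} := X ⋙ eCoyoneda SSet.{v} A

/-- The functoriality of `mapDiagram` in the diagram. -/
abbrev mapDiagramMap (A : C) {X Y : J ⥤ C} (f : X ⟶ Y) : mapDiagram A X ⟶ mapDiagram A Y :=
  Functor.whiskerRight f _

/-- The functoriality of `mapDiagram` in the object. -/
abbrev mapDiagramPre {A B : C} (i : A ⟶ B) (X : J ⥤ C) : mapDiagram B X ⟶ mapDiagram A X :=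
  Functor.whiskerLeft X ((eHomFunctor SSet.{v} C).map i.op)

/-- The projections of the homotopy limit. -/
abbrev holimπ (X : J ⥤ C) (j : J) : (holim C J).obj X ⟶ cot ((nerveOver J).obj j) (X.obj j) :=
  end_.π ((cotensorNerve C J).obj X) j

lemma holim_condition (X : J ⥤ C) {i j : J} (φ : i ⟶ j) :
    holimπ X i ≫ (TensoredCotensored.cotensor.obj (op ((nerveOver J).obj i))).map (X.map φ) =
      holimπ X j ≫ cotRestr ((nerveOver J).map φ) (X.obj j) :=
  end_.condition ((cotensorNerve C J).obj X) φ

lemma holim_map_π {X Y : J ⥤ C} (f : X ⟶ Y) (j : J) :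
    (holim C J).map f ≫ holimπ Y j =
      holimπ X j ≫ (TensoredCotensored.cotensor.obj (op ((nerveOver J).obj j))).map (f.app j) :=
  end_.map_π ((cotensorNerve C J).map f) j

/-- Maps into the homotopy limit of `X` are natural transformations `N(J ↓ j) ⟶ Map(A, X j)`. -/
def homHolimEquiv (A : C) (X : J ⥤ C) :
    (A ⟶ (holim C J).obj X) ≃ (nerveOver J ⟶ mapDiagram A X) where
  toFun a :=
    { app j := homCotEquiv ((nerveOver J).obj j) A (X.obj j) (a ≫ holimπ X j)
      naturality i j φ := by
        refine (homCotEquiv_comp_cotRestr ((nerveOver J).map φ) _).symm.trans ?_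
        refine Eq.trans ?_ (homCotEquiv_comp_map _ _ (X.map φ))
        rw [Category.assoc, Category.assoc, holim_condition] }
  invFun α := end_.lift (F := (cotensorNerve C J).obj X)
    (fun j ↦ (homCotEquiv ((nerveOver J).obj j) A (X.obj j)).symm (α.app j)) (fun i j φ ↦ by
      apply (homCotEquiv _ _ _).injective
      refine (homCotEquiv_comp_map _ _ (X.map φ)).trans ?_
      refine Eq.trans ?_ (homCotEquiv_comp_cotRestr ((nerveOver J).map φ) _).symm
      refine (congrArg (· ≫ eHomWhiskerLeft SSet.{v} A (X.map φ))
        (Equiv.apply_symm_apply (homCotEquiv ((nerveOver J).obj i) A (X.obj i)) _)).trans ?_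
      refine (α.naturality φ).symm.trans ?_
      exact congrArg ((nerveOver J).map φ ≫ ·) (Equiv.apply_symm_apply _ _).symm)
  left_inv a := end_.hom_ext (F := (cotensorNerve C J).obj X) fun j ↦
    (end_.lift_π _ _ j).trans (Equiv.symm_apply_apply _ _)
  right_inv α := by
    ext1
    ext1 j
    refine (congrArg (homCotEquiv ((nerveOver J).obj j) A (X.obj j)) (end_.lift_π _ _ j)).trans (Equiv.apply_symm_apply _ _)

lemma homHolimEquiv_app {A : C} {X : J ⥤ C} (a : A ⟶ (holim C J).obj X) (j : J) :
    (homHolimEquiv A X a).app j = homCotEquiv ((nerveOver J).obj j) A (X.obj j) (a ≫ holimπ X j) :=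
  rfl

lemma homHolimEquiv_comp_left {A B : C} (i : A ⟶ B) {X : J ⥤ C} (b : B ⟶ (holim C J).obj X) :
    homHolimEquiv A X (i ≫ b) = homHolimEquiv B X b ≫ mapDiagramPre i X := by
  ext1
  ext1 j
  rw [homHolimEquiv_app, Category.assoc, homCotEquiv_comp_left]
  rfl

lemma homHolimEquiv_comp_map {A : C} {X Y : J ⥤ C} (a : A ⟶ (holim C J).obj X) (f : X ⟶ Y) :
    homHolimEquiv A Y (a ≫ (holim C J).map f) = homHolimEquiv A X a ≫ mapDiagramMap A f := by
  ext1
  ext1 j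
  rw [homHolimEquiv_app, Category.assoc, holim_map_π, ← Category.assoc, homCotEquiv_comp_map]
  rfl

/-- The homotopy limit of an objectwise trivial fibration is a trivial fibration. -/
lemma trivialFibrations_holim_map {X Y : J ⥤ C} (f : X ⟶ Y)
    (hf : ∀ j, trivialFibrations C (f.app j)) :
    trivialFibrations C ((holim C J).map f) := by
  rw [← cofibrations_rlp]
  intro A B i hi
  refine ⟨fun {a b} sq ↦ ?_⟩
  -- Objectwise `p` is the corner map of `i` and `f.app j`; lifting `i` against `holim f` means
  -- lifting N(J ↓ -) against `p`.
  let p : mapDiagram B X ⟶ pullback (mapDiagramMap A f) (mapDiagramPre i Y) :=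
    pullback.lift (mapDiagramPre i X) (mapDiagramMap B f) (by
      ext1
      ext1 j
      exact (eHom_whisker_exchange SSet.{v} i (f.app j)).symm)
  have hp (j : J) : SSet.modelCategoryQuillen.I.{v}.rlp (p.app j) := by
    have hc := IsSimplicialModelCategory.trivialFibration_cornerMap i (f.app j)
      ((cofibration_iff i).2 hi) ((fibration_iff _).2 (hf j).1)
      (Or.inr ((weakEquivalence_iff _).2 (hf j).2))
    have hpb : IsPullback ((pullback.fst (mapDiagramMap A f) (mapDiagramPre i Y)).app j)
        ((pullback.snd (mapDiagramMap A f) (mapDiagramPre i Y)).app j)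
        (eHomWhiskerLeft SSet.{v} A (f.app j)) (eHomWhiskerRight SSet.{v} i (Y.obj j)) :=
      (IsPullback.of_hasPullback (mapDiagramMap A f) (mapDiagramPre i Y)).map
        ((evaluation J SSet.{v}).obj j)
    exact rlp_of_isPullback hpb _ hc
      (congr(($(pullback.lift_fst (mapDiagramPre i X) (mapDiagramMap B f) _)).app j).trans
        (pullback.lift_fst _ _ _).symm)
      (congr(($(pullback.lift_snd (mapDiagramPre i X) (mapDiagramMap B f) _)).app j).trans
        (pullback.lift_snd _ _ _).symm)
  obtain ⟨e, he⟩ := exists_lift_nerveOver hp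
    (pullback.lift (homHolimEquiv A X a) (homHolimEquiv B Y b) (by
      rw [← homHolimEquiv_comp_map, ← homHolimEquiv_comp_left, sq.w]))
  refine ⟨⟨⟨(homHolimEquiv B X).symm e, ?_, ?_⟩⟩⟩
  · apply (homHolimEquiv _ _).injective
    rw [homHolimEquiv_comp_left, Equiv.apply_symm_apply]
    have := congr($he ≫ pullback.fst _ _)
    rwa [Category.assoc, pullback.lift_fst, pullback.lift_fst] at this
  · apply (homHolimEquiv _ _).injective
    rw [homHolimEquiv_comp_map, Equiv.apply_symm_apply]
    have := congr($he ≫ pullback.snd _ _)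
    rwa [Category.assoc, pullback.lift_snd, pullback.lift_snd] at this

end HomHolim

/-! ### Lifting against the simplicial interval -/

section Interval

open SSet Simplicial MonoidalCategory

/-- The vertices of the simplicial interval. -/
def vertex (k : Fin 2) : 𝟙_ SSet.{v} ⟶ Δ[1] := SSet.const (stdSimplex.obj₀Equiv.symm k)

/-- Restricting a degenerate simplex on a vertex to dimension zero recovers the vertex. -/
lemma vertex_app_injective (n : SimplexCategoryᵒᵖ) {k l : Fin 2} {x y : (𝟙_ SSet.{v}).obj n}
    (h : (vertex.{v} k).app n x = (vertex.{v} l).app n y) : k = l := by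
  apply stdSimplex.obj₀Equiv.{v}.symm.injective
  have (i : Fin 2) (z : (𝟙_ SSet.{v}).obj n) :
      (Δ[1] : SSet.{v}).map (SimplexCategory.const (SimplexCategory.mk 0) n.unop 0).op
        ((vertex.{v} i).app n z) = stdSimplex.obj₀Equiv.{v}.symm i := by
    rw [← NatTrans.naturality_apply]
    exact stdSimplex.obj₀Equiv.injective rfl
  rw [← this k x, ← this l y, h]

lemma exists_lift_vertex {Z W : SSet.{v}} {p : Z ⟶ W} (hp : modelCategoryQuillen.J.{v}.rlp p)
    (z : 𝟙_ SSet.{v} ⟶ Z) (w : Δ[1] ⟶ W) (h : z ≫ p = vertex 0 ≫ w) :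
    ∃ e : Δ[1] ⟶ Z, vertex 0 ≫ e = z ∧ e ≫ p = w := by
  have := (modelCategoryQuillen.fibration_iff p).2 hp
  -- The horn Λ[1, 0] has the single face j = 1, opposite to vertex 1, which is vertex 0.
  obtain ⟨e, he, he'⟩ := horn.IsCompatible.exists_lift (i := 0) (n := 0)
    (f := fun _ _ ↦ CartesianMonoidalCategory.toUnit _ ≫ z) trivial p w (fun j hj ↦ by
      obtain rfl : j = 1 := Fin.eq_one_of_ne_zero j hj
      rw [Category.assoc, h, stdSimplex.δ_one_eq_const]
      rfl)
  refine ⟨e, ?_, he'⟩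
  have h₁ := he 1 (by simp)
  rw [stdSimplex.δ_one_eq_const] at h₁
  let t : 𝟙_ SSet.{v} ⟶ Δ[0] := SSet.const (stdSimplex.obj₀Equiv.symm 0)
  refine Eq.trans ?_ (congr(t ≫ $h₁).trans ?_)
  · rfl
  · rw [← Category.assoc, CartesianMonoidalCategory.toUnit_unique (t ≫ _) (𝟙 _), Category.id_comp]

/-- The map out of a discrete simplicial set with two vertices determined by two vertices. -/
def twoPointsDesc {Z : SSet.{v}} (z₀ z₁ : 𝟙_ SSet.{v} ⟶ Z) :
    (Functor.const SimplexCategoryᵒᵖ).obj (ULift.{v} Bool) ⟶ Z where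
  app n := ↾fun b ↦ bif b.down then z₁.app n PUnit.unit else z₀.app n PUnit.unit
  naturality n m f := by
    ext ⟨_ | _⟩
    · exact NatTrans.naturality_apply z₀ f PUnit.unit
    · exact NatTrans.naturality_apply z₁ f PUnit.unit

lemma twoPointsDesc_comp {Z W : SSet.{v}} (z₀ z₁ : 𝟙_ SSet.{v} ⟶ Z) (p : Z ⟶ W) :
    twoPointsDesc z₀ z₁ ≫ p = twoPointsDesc (z₀ ≫ p) (z₁ ≫ p) := by
  ext n ⟨_ | _⟩ <;> rfl

lemma twoPointsDesc_injective {Z : SSet.{v}} {z₀ z₁ z₀' z₁' : 𝟙_ SSet.{v} ⟶ Z}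
    (h : twoPointsDesc z₀ z₁ = twoPointsDesc z₀' z₁') : z₀ = z₀' ∧ z₁ = z₁' := by
  constructor
  · ext n x
    exact congr(($h).app n ⟨false⟩)
  · ext n x
    exact congr(($h).app n ⟨true⟩)

instance : Mono (twoPointsDesc (vertex.{v} 0) (vertex 1)) := by
  have (n : SimplexCategoryᵒᵖ) : Mono ((twoPointsDesc (vertex.{v} 0) (vertex 1)).app n) := by
    rw [mono_iff_injective]
    rintro ⟨_ | _⟩ ⟨_ | _⟩ h
    · rfl
    · exact absurd (vertex_app_injective n (x := PUnit.unit) (y := PUnit.unit) h) (by simp)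
    · exact absurd (vertex_app_injective n (x := PUnit.unit) (y := PUnit.unit) h) (by simp)
    · rfl
  exact NatTrans.mono_of_mono_app _

/-- The constant simplicial set on two points plays the role of ∂Δ[1]. -/
lemma exists_lift_vertices {Z W : SSet.{v}} {p : Z ⟶ W} (hp : modelCategoryQuillen.I.{v}.rlp p)
    (z₀ z₁ : 𝟙_ SSet.{v} ⟶ Z) (w : Δ[1] ⟶ W) (h₀ : z₀ ≫ p = vertex 0 ≫ w)
    (h₁ : z₁ ≫ p = vertex 1 ≫ w) :
    ∃ e : Δ[1] ⟶ Z, vertex 0 ≫ e = z₀ ∧ vertex 1 ≫ e = z₁ ∧ e ≫ p = w := by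
  rw [← rlp_monomorphisms] at hp
  have := hp (twoPointsDesc (vertex.{v} 0) (vertex 1))
    (MorphismProperty.monomorphisms.infer_property _)
  have sq : CommSq (twoPointsDesc z₀ z₁) (twoPointsDesc (vertex.{v} 0) (vertex 1)) p w :=
    ⟨by rw [twoPointsDesc_comp, twoPointsDesc_comp, h₀, h₁]⟩
  have h := sq.fac_left
  rw [twoPointsDesc_comp] at h
  obtain ⟨h, h'⟩ := twoPointsDesc_injective h
  exact ⟨sq.lift, h, h', sq.fac_right⟩

end Interval

/-! ### Path objects and Ken Brown's argument -/

section PathObject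

open Simplicial MonoidalCategory

variable {C : Type u} [Category.{v} C] [SimplicialCategory C]

lemma cornerMap_fst {A B X Y : C} (i : A ⟶ B) (p : X ⟶ Y) :
    cornerMap i p ≫ pullback.fst _ _ = eHomWhiskerRight SSet.{v} i X :=
  pullback.lift_fst _ _ _

variable [TensoredCotensored C]

/-- Map(X, ⊤) is terminal, since maps from K into it are maps K ⊗ X ⟶ ⊤; so the target of the corner
map is just Map(A, Y). -/
lemma rlp_eHomWhiskerRight [HasTerminal C] {T : MorphismProperty SSet.{v}} {A B Y : C} (i : A ⟶ B)
    (h : T.rlp (cornerMap i (terminal.from Y))) : T.rlp (eHomWhiskerRight SSet.{v} i Y) := by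
  intro K L k hk
  have hT (K : SSet.{v}) (X : C) : Subsingleton (K ⟶ SimplicialCategory.sHom X (⊤_ C)) :=
    (homTensorEquiv K X (⊤_ C)).symm.subsingleton
  refine ⟨fun {a b} sq ↦ ?_⟩
  have := h k hk
  have sq' : CommSq a k (cornerMap i (terminal.from Y))
      (pullback.lift b (homTensorEquiv L B (⊤_ C) (terminal.from _)) ((hT _ _).elim _ _)) :=
    ⟨pullback.hom_ext (by
        rw [Category.assoc, Category.assoc, cornerMap_fst, sq.w]
        exact congr(k ≫ $(pullback.lift_fst _ _ _)).symm) ((hT _ _).elim _ _)⟩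
  refine ⟨⟨⟨sq'.lift, sq'.fac_left, ?_⟩⟩⟩
  have := congr($(sq'.fac_right) ≫ pullback.fst _ _)
  rwa [Category.assoc, cornerMap_fst, pullback.lift_fst] at this

/-- The evaluation of paths at an end point. -/
def evPath (k : Fin 2) (Y : C) : cot Δ[1] Y ⟶ Y :=
  (eHomEquiv SSet.{v}).symm (vertex k ≫ homCotEquiv _ _ Y (𝟙 _))

lemma eHomEquiv_comp_evPath (k : Fin 2) {A Y : C} (a : A ⟶ cot Δ[1] Y) :
    eHomEquiv SSet.{v} (a ≫ evPath k Y) = vertex k ≫ homCotEquiv _ A Y a := by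
  rw [eHomEquiv_comp_eHomWhiskerRight, evPath, Equiv.apply_symm_apply, Category.assoc,
    ← homCotEquiv_comp_left, Category.comp_id]

lemma map_comp_evPath (k : Fin 2) {X Y : C} (f : X ⟶ Y) :
    (TensoredCotensored.cotensor.obj (op Δ[1])).map f ≫ evPath k Y = evPath k X ≫ f := by
  apply (eHomEquiv SSet.{v}).injective
  rw [eHomEquiv_comp_evPath, eHomEquiv_comp_eHomWhiskerLeft, evPath, Equiv.apply_symm_apply,
    Category.assoc, ← homCotEquiv_comp_map, Category.id_comp]

/-- The constant paths. -/
def constPath (Y : C) : Y ⟶ cot Δ[1] Y :=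
  (homCotEquiv _ Y Y).symm (CartesianMonoidalCategory.toUnit _ ≫ eHomEquiv SSet.{v} (𝟙 Y))

lemma comp_constPath {X Y : C} (f : X ⟶ Y) :
    f ≫ constPath Y = constPath X ≫ (TensoredCotensored.cotensor.obj (op Δ[1])).map f := by
  apply (homCotEquiv _ _ _).injective
  rw [homCotEquiv_comp_left, homCotEquiv_comp_map, constPath, constPath, Equiv.apply_symm_apply,
    Equiv.apply_symm_apply, Category.assoc, Category.assoc, ← eHomEquiv_comp_eHomWhiskerLeft,
    ← eHomEquiv_comp_eHomWhiskerRight, Category.id_comp, Category.comp_id]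

lemma constPath_evPath (k : Fin 2) (Y : C) : constPath Y ≫ evPath k Y = 𝟙 Y := by
  apply (eHomEquiv SSet.{v}).injective
  rw [eHomEquiv_comp_evPath, constPath, Equiv.apply_symm_apply, ← Category.assoc,
    CartesianMonoidalCategory.toUnit_unique (vertex k ≫ _) (𝟙 _), Category.id_comp]

variable [ModelCategory C] [IsSimplicialModelCategory C]

/-- Lifting a cofibration `i` against `evPath 0 Y` transposes to lifting vertex 0 of Δ[1] against
the Kan fibration Map(B, Y) ⟶ Map(A, Y). -/
lemma trivialFibrations_evPath (Y : C) (hY : IsFibrant Y) :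
    trivialFibrations C (evPath 0 Y) := by
  rw [← cofibrations_rlp]
  intro A B i hi
  refine ⟨fun {a b} sq ↦ ?_⟩
  obtain ⟨e, he, he'⟩ := exists_lift_vertex
    (rlp_eHomWhiskerRight i (IsSimplicialModelCategory.fibration_cornerMap i (terminal.from Y)
      ((cofibration_iff i).2 hi) hY)) (eHomEquiv SSet.{v} b) (homCotEquiv _ _ _ a) (by
        rw [← eHomEquiv_comp_eHomWhiskerRight, ← eHomEquiv_comp_evPath, sq.w])
  refine ⟨⟨⟨(homCotEquiv _ _ _).symm e, ?_, ?_⟩⟩⟩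
  · apply (homCotEquiv _ _ _).injective
    rw [homCotEquiv_comp_left, Equiv.apply_symm_apply, he']
  · apply (eHomEquiv SSet.{v}).injective
    rw [eHomEquiv_comp_evPath, Equiv.apply_symm_apply, he]

/-- The projection from the mapping path object of a morphism between fibrant objects is a
fibration. -/
lemma fibration_evPath_of_isPullback {P X Y : C} (hX : IsFibrant X) (hY : IsFibrant Y) {f : X ⟶ Y}
    {fst : P ⟶ X} {snd : P ⟶ cot Δ[1] Y} (h : IsPullback fst snd f (evPath 0 Y)) :
    fibrations C (snd ≫ evPath 1 Y) := by
  rw [← trivialCofibrations_rlp]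
  intro A B i hi
  refine ⟨fun {a b} sq ↦ ?_⟩
  have hX' := hX.mem
  rw [← trivialCofibrations_rlp] at hX'
  have := hX' i hi
  have sqX : CommSq (a ≫ fst) i (terminal.from X) (terminal.from B) := ⟨Subsingleton.elim _ _⟩
  -- The lift to `X` fixes the start of the path and `b` its end. As `i` is a trivial cofibration,
  -- Map(B, Y) ⟶ Map(A, Y) is a trivial Kan fibration, so a path with both ends prescribed exists.
  obtain ⟨e, he₀, he₁, he⟩ := exists_lift_vertices
    (rlp_eHomWhiskerRight i (IsSimplicialModelCategory.trivialFibration_cornerMap i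
      (terminal.from Y) ((cofibration_iff i).2 hi.1) hY (Or.inl ((weakEquivalence_iff _).2 hi.2))))
    (eHomEquiv SSet.{v} (sqX.lift ≫ f)) (eHomEquiv SSet.{v} b) (homCotEquiv _ _ _ (a ≫ snd))
    (by rw [← eHomEquiv_comp_eHomWhiskerRight, ← eHomEquiv_comp_evPath, sqX.fac_left_assoc,
      Category.assoc, Category.assoc, h.w])
    (by rw [← eHomEquiv_comp_eHomWhiskerRight, ← eHomEquiv_comp_evPath, ← sq.w, Category.assoc])
  refine ⟨⟨⟨h.lift sqX.lift ((homCotEquiv _ _ _).symm e) ?_, h.hom_ext ?_ ?_, ?_⟩⟩⟩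
  · apply (eHomEquiv SSet.{v}).injective
    rw [eHomEquiv_comp_evPath, Equiv.apply_symm_apply, he₀]
  · rw [Category.assoc, h.lift_fst, sqX.fac_left]
  · apply (homCotEquiv _ _ _).injective
    rw [Category.assoc, h.lift_snd, homCotEquiv_comp_left, Equiv.apply_symm_apply, he]
  · apply (eHomEquiv SSet.{v}).injective
    rw [h.lift_snd_assoc, eHomEquiv_comp_evPath, Equiv.apply_symm_apply, he₁]

variable {J : Type v} [SmallCategory J]

/-- The objectwise evaluation of paths. -/
abbrev evPathDiagram (k : Fin 2) (Y : J ⥤ C) :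
    Y ⋙ TensoredCotensored.cotensor.obj (op Δ[1]) ⟶ Y where
  app j := evPath k (Y.obj j)
  naturality _ _ φ := map_comp_evPath k (Y.map φ)

/-- The objectwise constant paths. -/
abbrev constPathDiagram (Y : J ⥤ C) : Y ⟶ Y ⋙ TensoredCotensored.cotensor.obj (op Δ[1]) where
  app j := constPath (Y.obj j)
  naturality _ _ φ := comp_constPath (Y.map φ)

/-- Homotopy limits preserve objectwise weak equivalences between objectwise fibrant diagrams. -/
lemma weakEquivalence_holim_map {X Y : J ⥤ C} (f : X ⟶ Y) (hX : ∀ j, IsFibrant (X.obj j))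
    (hY : ∀ j, IsFibrant (Y.obj j)) (hf : ∀ j, WeakEquivalence (f.app j)) :
    WeakEquivalence ((holim C J).map f) := by
  -- Mapping path factorization: `f = s ≫ q`, where `s` (constant paths) is a section of the
  -- objectwise trivial fibration `r`.
  let r := pullback.fst f (evPathDiagram 0 Y)
  let q := pullback.snd f (evPathDiagram 0 Y) ≫ evPathDiagram 1 Y
  let s : X ⟶ pullback f (evPathDiagram 0 Y) :=
    pullback.lift (𝟙 X) (f ≫ constPathDiagram Y) (by
      ext j
      have := constPath_evPath 0 (Y.obj j)
      simp [this])
  have hsr : s ≫ r = 𝟙 X := pullback.lift_fst _ _ _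
  have hsq : s ≫ q = f := by
    rw [← Category.assoc, pullback.lift_snd]
    ext j
    have := constPath_evPath 1 (Y.obj j)
    simp [this]
  have hpb (j : J) : IsPullback (r.app j) ((pullback.snd f (evPathDiagram 0 Y)).app j) (f.app j)
      (evPath 0 (Y.obj j)) :=
    (IsPullback.of_hasPullback f (evPathDiagram 0 Y)).map ((evaluation J C).obj j)
  have hr (j : J) : trivialFibrations C (r.app j) :=
    MorphismProperty.of_isPullback (hpb j).flip (trivialFibrations_evPath _ (hY j))
  have hs (j : J) : WeakEquivalence (s.app j) := by
    have := (weakEquivalence_iff _).2 (hr j).2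
    exact weakEquivalence_of_postcomp_of_fac congr(($hsr).app j)
  have hq (j : J) : trivialFibrations C (q.app j) := by
    refine ⟨fibration_evPath_of_isPullback (hX j) (hY j) (hpb j), (weakEquivalence_iff _).1 ?_⟩
    have := hs j
    have := hf j
    exact weakEquivalence_of_precomp_of_fac congr(($hsq).app j)
  have hr' := (weakEquivalence_iff _).2 (trivialFibrations_holim_map r hr).2
  have hq' := (weakEquivalence_iff _).2 (trivialFibrations_holim_map q hq).2
  -- `s` need not be a fibration; its image is an equivalence as a section of the equivalence `holim
  -- r`.
  have hs' : WeakEquivalence ((holim C J).map s) :=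
    weakEquivalence_of_postcomp_of_fac (fg := 𝟙 _) (by
      rw [← (holim C J).map_id, ← hsr, (holim C J).map_comp])
  rw [← hsq, (holim C J).map_comp]
  infer_instance

end PathObject

/-! ### Fibrant approximations and colimits -/

section ColimitComparison

variable {C : Type u} [Category.{v} C] [ModelCategory C]

lemma isFibrant_of_iso {X Y : C} (e : X ≅ Y) (hX : IsFibrant X) : IsFibrant Y := by
  rw [isFibrant_iff, ← terminal.comp_from e.inv]
  infer_instance

variable [HasColimitsOfSize.{v, v} C] {I : Type v} [SmallCategory I]

/-- A fibrant approximation commutes with `I`-indexed colimits up to weak equivalence if weak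
equivalences are stable under `I`-indexed colimits. -/
lemma FibrantApproximation.weakEquivalence_of_isColimit
    (weakEquivalence_colim : ∀ (X Y : I ⥤ C) (f : X ⟶ Y),
      (∀ i, WeakEquivalence (f.app i)) → WeakEquivalence (colimMap f))
    (F : FibrantApproximation C) {Z : I ⥤ C} {c : Cocone Z} (hc : IsColimit c)
    {d : Cocone (Z ⋙ F.functor)} (hd : IsColimit d) (m : d.pt ⟶ F.functor.obj c.pt)
    (hm : ∀ i, d.ι.app i ≫ m = F.functor.map (c.ι.app i)) : WeakEquivalence m := by
  let f : Z ⟶ Z ⋙ F.functor := Functor.whiskerLeft Z F.ι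
  have hf : WeakEquivalence (colimMap f) :=
    weakEquivalence_colim _ _ f fun i ↦ F.weakEquivalence_app _
  have hι := F.weakEquivalence_app c.pt
  -- Naturality of `F.ι` identifies both maps colim Z ⟶ F(colim Z); two-out-of-three then applies to
  -- `m`.
  have fac : (colimMap f ≫ ((colimit.isColimit _).coconePointUniqueUpToIso hd).hom) ≫ m =
      ((colimit.isColimit _).coconePointUniqueUpToIso hc).hom ≫ F.ι.app c.pt := by
    refine colimit.hom_ext fun i ↦ ?_
    rw [Category.assoc, ι_colimMap_assoc, colimit.comp_coconePointUniqueUpToIso_hom_assoc,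
      colimit.comp_coconePointUniqueUpToIso_hom_assoc, hm]
    exact (F.ι.naturality (c.ι.app i)).symm
  exact weakEquivalence_of_precomp_of_fac fac

open Cardinal in
attribute [local instance] fact_isRegular_aleph0 in
lemma isIso_colimit_post [IsFiltered I] {D E : Type*} [Category* D] [Category* E] (X : I ⥤ D)
    [HasColimitsOfShape I D] [HasColimitsOfShape I E] (G : D ⥤ E)
    [Functor.IsFinitelyAccessible.{v} G] : IsIso (colimit.post X G) := by
  have : IsCardinalFiltered I ℵ₀ := isCardinalFiltered_aleph0_iff I |>.2 inferInstance
  have := G.preservesColimitsOfShape_of_isCardinalAccessible ℵ₀ I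
  infer_instance

end ColimitComparison

end SimplicialHolim

end

theorem lemma5p1
    {C : Type u} [Category.{v} C] [ModelCategory C] [SimplicialCategory C]
    [SimplicialHolim.TensoredCotensored C] [SimplicialHolim.IsSimplicialModelCategory C]
    [IsLocallyFinitelyPresentable.{v} C]
    -- the tensor preserves finitely presentable objects
    (tensor_fp : ∀ (K : SSet.{v}) (X : C), IsFinitelyPresentable.{v} K →
      IsFinitelyPresentable.{v} X →
      IsFinitelyPresentable.{v}
        ((SimplicialHolim.TensoredCotensored.tensor.obj K).obj X))
    (I : Type v) [SmallCategory I] [IsFiltered I]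
    (weakEquivalence_colim : ∀ (X Y : I ⥤ C) (f : X ⟶ Y),
      (∀ i, WeakEquivalence (f.app i)) → WeakEquivalence (colimMap f))
    (isFibrant_colim : ∀ X : I ⥤ C, (∀ i, IsFibrant (X.obj i)) → IsFibrant (colimit X))
    (J : Type v) [SmallCategory J] [FinCategory J]
    (nerve_fp : ∀ j : J, IsFinitelyPresentable.{v} (nerve (Over j)))
    (F : SimplicialHolim.FibrantApproximation C) (X : I ⥤ J ⥤ C) :
    -- the natural map `colim_I (cholim_J X) ⟶ cholim_J (colim_I X)`
    WeakEquivalence (colimit.post X (SimplicialHolim.cholim J F)) := by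
  have := SimplicialHolim.isFinitelyAccessible_holim tensor_fp J nerve_fp
  let W := (Functor.whiskeringRight J C C).obj F.functor
  have h₁ : IsIso (colimit.post (X ⋙ W) (SimplicialHolim.holim C J)) :=
    SimplicialHolim.isIso_colimit_post _ _
  have h₂ : WeakEquivalence ((SimplicialHolim.holim C J).map (colimit.post X W)) := by
    refine SimplicialHolim.weakEquivalence_holim_map _ (fun j ↦ ?_)
      (fun j ↦ F.isFibrant_obj _) (fun j ↦ ?_)
    -- Colimits of diagrams are computed objectwise, so both goals reduce to hypotheses on colimits
    -- in `C`.
    · exact SimplicialHolim.isFibrant_of_iso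
        (colimitObjIsoColimitCompEvaluation (X ⋙ W) j).symm
        (isFibrant_colim _ fun i ↦ F.isFibrant_obj _)
    · exact F.weakEquivalence_of_isColimit weakEquivalence_colim
        (isColimitOfPreserves ((evaluation J C).obj j) (colimit.isColimit X))
        (isColimitOfPreserves ((evaluation J C).obj j) (colimit.isColimit (X ⋙ W))) _
        (fun i ↦ congr(($(colimit.ι_post X W i)).app j))
  have h₃ : WeakEquivalence (colimit.post (X ⋙ W) (SimplicialHolim.holim C J) ≫
      (SimplicialHolim.holim C J).map (colimit.post X W)) := inferInstance
  exact (colimit.post_post X W (SimplicialHolim.holim C J)) ▸ h₃
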